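/- Let $S_0=\{1,\dots,s_0\}$ with $s_0\ge 1$, $\mathbb H=\{-1,0,1\}$ and $\mathbb H_+=\{0,1\}$. Let $A_{i,j}$ ($i,j\in\mathbb H$), $A^{(1)}_{i,j}$ ($i\in\mathbb H,\ j\in\mathbb H_+$), $A^{(2)}_{i,j}$ ($i\in\mathbb H_+,\ j\in\mathbb H$) and $A^{(0)}_{i,j}$ ($i,j\in\mathbb H_+$) be nonnegative $s_0\times s_0$ matrices such that the sum of the matrices in each of the four families is a stochastic matrix (they are the transition blocks of a two-dimensional quasi-birth-and-death process). Let $\tilde Y$ be the Markov chain on $\mathbb Z^2\times S_0$ whose transition block from $(x_1,x_2)$ to $(x_1+i,x_2+j)$ is $A_{i,j}$ for $i,j\in\mathbb H$ and zero for all other increments. Let $\tilde Y^{(1)}$ be the Markov chain on $\mathbb Z\times\mathbb Z_+\times S_0$ whose transition block from $(x_1,x_2)$ to $(x_1+i,x_2+j)$ is $A_{i,j}$ ($i,j\in\mathbb H$) if $x_2\neq0$, is $A^{(1)}_{i,j}$ ($i\in\mathbb H$, $j\in\mathbb H_+$) if $x_2=0$, and is zero for all other increments. Let $\tilde Y^{(2)}$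 be the Markov chain on $\mathbb Z_+\times\mathbb Z\times S_0$ whose transition block from $(x_1,x_2)$ to $(x_1+i,x_2+j)$ is $A_{i,j}$ ($i,j\in\mathbb H$) if $x_1\neq0$, is $A^{(2)}_{i,j}$ ($i\in\mathbb H_+$, $j\in\mathbb H$) if $x_1=0$, and is zero for all other increments. Assume that $\tilde Y$, $\tilde Y^{(1)}$ and $\tilde Y^{(2)}$ are irreducible and aperiodic. For a complex square matrix $M$ let $\mathrm{spr}(M)$ be the maximum modulus of its eigenvalues. For nonzero $z,z_1,z_2\in\mathbb C$ put $C(z_1,z_2)=\sum_{i,j\in\mathbb H}A_{i,j}z_1^iz_2^j$, $A_{*,j}(z)=\sum_{i\in\mathbb H}A_{i,j}z^i$ for $j\in\mathbb H$, and $A^{(1)}_{*,j}(z)=\sum_{i\in\mathbb H}A^{(1)}_{i,j}z^i$ for $j\in\mathbb H_+$. Let $$\bar\Gamma=\{(s_1,s_2)\in\mathbb R^2:\ \mathrm{spr}(C(e^{s_1},e^{s_2}))\le1\},\qquad \underline z_1^*=\exp\Big(\inf_{(s_1,s_2)\in\bar\Gamma}s_1\Big),\qquad \bar z_1^*=\exp\Big(\sup_{(s_1,s_2)\in\bar\Gamma}s_1\Big).$$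 For $n\ge1$ let $\mathscr I_{D,1,n}$ be the set of all $(i_1,\dots,i_n)\in\mathbb H^n$ with $\sum_{l=1}^k i_l\ge0$ for $1\le k\le n-1$ and $\sum_{l=1}^n i_l=-1$, and put $$D_1^{(n)}(z)=\sum_{(i_1,\dots,i_n)\in\mathscr I_{D,1,n}}A_{*,i_1}(z)\cdots A_{*,i_n}(z),\qquad G_1(z)=\sum_{n=1}^\infty D_1^{(n)}(z),\qquad C_1(z,X)=A^{(1)}_{*,0}(z)+A^{(1)}_{*,1}(z)X .$$ Then for every $z\in\mathbb C$ with $\underline z_1^*<|z|\le\bar z_1^*$ and $z\ne|z|$, the series defining $G_1(z)$ and $G_1(|z|)$ converge absolutely, and $$\mathrm{spr}\big(C_1(z,G_1(z))\big)<\mathrm{spr}\big(C_1(|z|,G_1(|z|))\big).$$ -/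

import Mathlib

noncomputable section

namespace TwoDQBD

/-- The set `{-1, 0, 1}`. -/
def H : Finset ℤ := Finset.Icc (-1) 1

/-- The set `{0, 1}`. -/
def HPlus : Finset ℤ := Finset.Icc 0 1

/-- A real square matrix is stochastic if its entries are nonnegative and its rows sum to one. -/
def IsStochastic {S : Type*} [Fintype S] (M : Matrix S S ℝ) : Prop :=
  (∀ j j', 0 ≤ M j j') ∧ ∀ j, ∑ j', M j j' = 1

/-- The block matrices of a two-dimensional quasi-birth-and-death process with phase set `S`:
`A` in the interior, `A1` on the `x₁`-axis (`x₂ = 0`), `A2` on the `x₂`-axis (`x₁ = 0`),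
`A0` at the origin.  The first index is the increment of `x₁`, the second that of `x₂`.
Only the blocks with increments in the indicated ranges are constrained, and only they are used. -/
structure Model (S : Type*) [Fintype S] where
  A : ℤ → ℤ → Matrix S S ℝ
  A1 : ℤ → ℤ → Matrix S S ℝ
  A2 : ℤ → ℤ → Matrix S S ℝ
  A0 : ℤ → ℤ → Matrix S S ℝ
  A_nonneg : ∀ i ∈ H, ∀ k ∈ H, ∀ j j', 0 ≤ A i k j j'
  A1_nonneg : ∀ i ∈ H, ∀ k ∈ HPlus, ∀ j j', 0 ≤ A1 i k j j'
  A2_nonneg : ∀ i ∈ HPlus, ∀ k ∈ H, ∀ j j', 0 ≤ A2 i k j j'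
  A0_nonneg : ∀ i ∈ HPlus, ∀ k ∈ HPlus, ∀ j j', 0 ≤ A0 i k j j'
  A_stoch : IsStochastic (∑ i ∈ H, ∑ k ∈ H, A i k)
  A1_stoch : IsStochastic (∑ i ∈ H, ∑ k ∈ HPlus, A1 i k)
  A2_stoch : IsStochastic (∑ i ∈ HPlus, ∑ k ∈ H, A2 i k)
  A0_stoch : IsStochastic (∑ i ∈ HPlus, ∑ k ∈ HPlus, A0 i k)

section MarkovChain

variable {E : Type*} [DecidableEq E]

/-- The `n`-step transition probabilities of a Markov chain with one-step transition
probabilities `p`.  (For the chains below the rows of `p` have finite support.) -/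
def nStep (p : E → E → ℝ) : ℕ → E → E → ℝ
  | 0 => fun x y => if x = y then 1 else 0
  | n + 1 => fun x y => ∑' w, p x w * nStep p n w y

/-- Every state can be reached from every state. -/
def IsIrreducibleChain (p : E → E → ℝ) : Prop :=
  ∀ x y, ∃ n, 0 < nStep p n x y

/-- Every state has period one: the only common divisor of the possible return times is `1`. -/
def IsAperiodicChain (p : E → E → ℝ) : Prop :=
  ∀ x, ∀ d : ℕ, (∀ n, 1 ≤ n → 0 < nStep p n x x → d ∣ n) → d = 1

end MarkovChain

/-- The spectral radius of a complex square matrix, the maximum modulus of its eigenvalues. -/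
def spr {S : Type*} [Fintype S] [DecidableEq S] (M : Matrix S S ℂ) : ENNReal :=
  spectralRadius ℂ M

namespace Model

variable {S : Type*} [Fintype S] (Q : Model S)

/-- Transition probabilities of the chain on `ℤ × ℤ × S` without boundaries. -/
def pFree (x y : ℤ × ℤ × S) : ℝ :=
  if y.1 - x.1 ∈ H ∧ y.2.1 - x.2.1 ∈ H then
    Q.A (y.1 - x.1) (y.2.1 - x.2.1) x.2.2 y.2.2
  else 0

/-- Transition probabilities of the chain on `ℤ × ℤ₊ × S` whose only boundary is the
`x₁`-axis. -/
def pOne (x y : ℤ × ℕ × S) : ℝ :=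
  if x.2.1 ≠ 0 ∧ y.1 - x.1 ∈ H ∧ (y.2.1 : ℤ) - (x.2.1 : ℤ) ∈ H then
    Q.A (y.1 - x.1) ((y.2.1 : ℤ) - (x.2.1 : ℤ)) x.2.2 y.2.2
  else if x.2.1 = 0 ∧ y.1 - x.1 ∈ H ∧ (y.2.1 : ℤ) - (x.2.1 : ℤ) ∈ HPlus then
    Q.A1 (y.1 - x.1) ((y.2.1 : ℤ) - (x.2.1 : ℤ)) x.2.2 y.2.2
  else 0

/-- Transition probabilities of the chain on `ℤ₊ × ℤ × S` whose only boundary is the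
`x₂`-axis. -/
def pTwo (x y : ℕ × ℤ × S) : ℝ :=
  if x.1 ≠ 0 ∧ (y.1 : ℤ) - (x.1 : ℤ) ∈ H ∧ y.2.1 - x.2.1 ∈ H then
    Q.A ((y.1 : ℤ) - (x.1 : ℤ)) (y.2.1 - x.2.1) x.2.2 y.2.2
  else if x.1 = 0 ∧ (y.1 : ℤ) - (x.1 : ℤ) ∈ HPlus ∧ y.2.1 - x.2.1 ∈ H then
    Q.A2 ((y.1 : ℤ) - (x.1 : ℤ)) (y.2.1 - x.2.1) x.2.2 y.2.2
  else 0

variable [DecidableEq S]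

/-- The three chains obtained by removing boundaries are irreducible and aperiodic. -/
structure IrreducibleAperiodic : Prop where
  free_irreducible : IsIrreducibleChain Q.pFree
  free_aperiodic : IsAperiodicChain Q.pFree
  one_irreducible : IsIrreducibleChain Q.pOne
  one_aperiodic : IsAperiodicChain Q.pOne
  two_irreducible : IsIrreducibleChain Q.pTwo
  two_aperiodic : IsAperiodicChain Q.pTwo

/-- `C(z₁, z₂) = ∑ A_{i,k} z₁^i z₂^k`, the sum over `i, k ∈ {-1, 0, 1}`. -/
def C (z₁ z₂ : ℂ) : Matrix S S ℂ :=
  ∑ i ∈ H, ∑ k ∈ H, (z₁ ^ i * z₂ ^ k) • (Q.A i k).map Complex.ofReal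

/-- The set of all real `(s₁, s₂)` with `spr (C(e^{s₁}, e^{s₂})) ≤ 1`. -/
def GammaBar : Set (ℝ × ℝ) :=
  {s | spr (Q.C ((Real.exp s.1 : ℝ) : ℂ) ((Real.exp s.2 : ℝ) : ℂ)) ≤ 1}

/-- The exponential of the least first coordinate of a point of `GammaBar`. -/
def zLower : ℝ := Real.exp (sInf (Prod.fst '' Q.GammaBar))

/-- The exponential of the greatest first coordinate of a point of `GammaBar`. -/
def zUpper : ℝ := Real.exp (sSup (Prod.fst '' Q.GammaBar))

/-- `A_{*,k}(z) = ∑ A_{i,k} z^i`, the sum over `i ∈ {-1, 0, 1}`. -/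
def AStar (k : ℤ) (z : ℂ) : Matrix S S ℂ :=
  ∑ i ∈ H, z ^ i • (Q.A i k).map Complex.ofReal

/-- `A^{(1)}_{*,k}(z) = ∑ A^{(1)}_{i,k} z^i`, the sum over `i ∈ {-1, 0, 1}`. -/
def A1Star (k : ℤ) (z : ℂ) : Matrix S S ℂ :=
  ∑ i ∈ H, z ^ i • (Q.A1 i k).map Complex.ofReal

end Model

/-- A sequence `(i₁, …, iₙ)` of integers whose proper partial sums `i₁ + ⋯ + i_k`,
`1 ≤ k ≤ n - 1`, are nonnegative and whose total is `-1`. -/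
def IsDown {n : ℕ} (i : Fin n → ℤ) : Prop :=
  (∀ k : ℕ, 1 ≤ k → k < n → 0 ≤ ∑ l with l.val < k, i l) ∧ ∑ l, i l = -1

open Classical in
/-- The sequences `(i₁, …, iₙ)` in `{-1, 0, 1}` that satisfy `IsDown`. -/
def downSeq (n : ℕ) : Finset (Fin n → ℤ) :=
  (Fintype.piFinset fun _ => H).filter IsDown

namespace Model

variable {S : Type*} [Fintype S] [DecidableEq S] (Q : Model S)

/-- `D₁^{(n)}(z)`, the sum of `A_{*,i₁}(z) A_{*,i₂}(z) ⋯ A_{*,iₙ}(z)` over `downSeq n`. -/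
def D1 (n : ℕ) (z : ℂ) : Matrix S S ℂ :=
  ∑ i ∈ downSeq n, (List.ofFn fun l => Q.AStar (i l) z).prod

/-- `G₁(z) = ∑_{n ≥ 1} D₁^{(n)}(z)`. -/
def G1 (z : ℂ) : Matrix S S ℂ :=
  ∑' n : ℕ, Q.D1 (n + 1) z

/-- `C₁(z, X) = A^{(1)}_{*,0}(z) + A^{(1)}_{*,1}(z) X`. -/
def C1 (z : ℂ) (X : Matrix S S ℂ) : Matrix S S ℂ :=
  Q.A1Star 0 z + Q.A1Star 1 z * X

end Model

end TwoDQBD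

end

open Filter Topology Matrix

set_option linter.unusedSectionVars false

/-! The entries of $C_1(z,G_1(z))$ are series in integer powers of $z$ with nonnegative
coefficients, so they are dominated in modulus by the entries at $|z|$. By Perron–Frobenius
(`Communicates.spr_lt`), domination by an irreducible nonnegative matrix, strict at one entry, makes
the spectral radius strictly smaller. What remains is convergence, irreducibility, and one strict
entry.

Convergence: if $C(|z|,y)v\le v$ for some $y>0$ and some positive vector $v$, the expected value of
$v$ at the first passage to height zero is bounded (`sum_descent_mulVec_le`), so the series
converges. Such $y$ and $v$ exist (`exists_superharmonic_realC`) because, in logarithmic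
coordinates, the triples $(x,y,v)$ form a compact convex set whose projection to the first
coordinate is that of $\bar\Gamma$.

Irreducibility: up to positive weights, $C_1(|z|,G_1(|z|))$ describes the chain with one boundary
observed on that boundary (`communicates_realC1`).

Strictness: irreducibility of the free chain gives two first passages with the same end phases whose
horizontal displacements differ by one (`exists_boundary_hasConsecutivePassages`). Some entry then
contains both $z^m$ and $z^{m+1}$ with positive coefficients. Equality in the triangle inequality
would align these two powers and force $z=|z|$ (`HasTerm.norm_lt`). -/

namespace TwoDQBD

/-! ### Perron–Frobenius theory through superharmonic vectors. -/

section Perron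

variable {S : Type*} [Fintype S] [DecidableEq S]

/-- A square matrix is irreducible in the sense that any index leads to any other one through
positive entries. -/
def Communicates (M : Matrix S S ℝ) : Prop :=
  ∀ j k, Relation.ReflTransGen (fun a b => 0 < M a b) j k

attribute [local instance] Matrix.linftyOpNormedRing Matrix.linftyOpNormedAlgebra
  Matrix.linftyOpNormedAddCommGroup

/-- Gelfand's formula in the operator norm given by the largest absolute row sum. -/
theorem exists_pow_rowSum_le {M : Matrix S S ℝ} {t : ℝ} (ht : 0 < t)
    (h : spr (M.map Complex.ofReal) < ENNReal.ofReal t) :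
    ∃ N : ℕ, 1 ≤ N ∧ ∀ j, ∑ k, (M ^ N) j k ≤ t ^ N := by
  have hg := spectrum.pow_nnnorm_pow_one_div_tendsto_nhds_spectralRadius
    (M.map Complex.ofReal)
  have he := (hg.eventually_lt_const h).and (eventually_ge_atTop 1)
  obtain ⟨N, hN, hN1⟩ := he.exists
  refine ⟨N, hN1, fun j => ?_⟩
  have hN0 : (0 : ℝ) < N := by exact_mod_cast hN1
  have h1 : (‖(M.map Complex.ofReal) ^ N‖₊ : ENNReal) < ENNReal.ofReal t ^ (N : ℝ) := by
    have := ENNReal.rpow_lt_rpow hN hN0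
    rwa [← ENNReal.rpow_mul, one_div, inv_mul_cancel₀ hN0.ne', ENNReal.rpow_one] at this
  rw [ENNReal.rpow_natCast, ← ENNReal.ofReal_pow ht.le] at h1
  have h2 : ‖(M.map Complex.ofReal) ^ N‖ ≤ t ^ N := by
    have h3 : ENNReal.ofReal ‖(M.map Complex.ofReal) ^ N‖ < ENNReal.ofReal (t ^ N) := by
      rw [ofReal_norm]; exact h1
    exact ((ENNReal.ofReal_lt_ofReal_iff (by positivity)).1 h3).le
  have h4 : (M.map Complex.ofReal) ^ N = (M ^ N).map Complex.ofReal :=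
    (map_pow (Complex.ofRealHom.mapMatrix) M N).symm
  rw [h4, Matrix.linfty_opNorm_def] at h2
  have h5 : ∑ k, ‖((M ^ N).map Complex.ofReal) j k‖₊ ≤
      Finset.univ.sup fun i => ∑ k, ‖((M ^ N).map Complex.ofReal) i k‖₊ :=
    Finset.le_sup (f := fun i => ∑ k, ‖((M ^ N).map Complex.ofReal) i k‖₊) (Finset.mem_univ j)
  have h6 : ∑ k, ‖((M ^ N).map Complex.ofReal) j k‖ ≤ t ^ N := by
    refine le_trans ?_ h2
    simpa only [NNReal.coe_sum, coe_nnnorm] using NNReal.coe_le_coe.2 h5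
  refine le_trans (Finset.sum_le_sum fun k _ => ?_) h6
  simp only [Matrix.map_apply, Complex.norm_real]
  exact le_abs_self _

/-- Take $q=\sum_{n<N}t^{-n}M^n\mathbf 1$. Applying $M$ shifts the sum and multiplies it by $t$; the
boundary terms have the right sign because the row sums of $M^N$ are at most $t^N$. -/
theorem exists_superharmonic_of_spr_lt {M : Matrix S S ℝ} (hM : ∀ j k, 0 ≤ M j k) {t : ℝ}
    (ht : 0 < t) (h : spr (M.map Complex.ofReal) < ENNReal.ofReal t) :
    ∃ q : S → ℝ, (∀ j, 0 < q j) ∧ ∀ j, (M *ᵥ q) j ≤ t * q j := by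
  obtain ⟨N, hN, hN'⟩ := exists_pow_rowSum_le ht h
  have hpow : ∀ n j, 0 ≤ ((M ^ n) *ᵥ (fun _ => (1 : ℝ))) j := by
    intro n
    induction n with
    | zero => intro j; simp
    | succ n ih =>
      intro j
      rw [pow_succ', ← Matrix.mulVec_mulVec]
      exact Finset.sum_nonneg fun k _ => mul_nonneg (hM _ _) (ih k)
  let w : ℕ → S → ℝ := fun n => (t⁻¹ ^ n) • ((M ^ n) *ᵥ fun _ => (1 : ℝ))
  have hw : ∀ n, M *ᵥ w n = t • w (n + 1) := by
    intro n
    simp only [w, Matrix.mulVec_smul, Matrix.mulVec_mulVec, smul_smul]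
    rw [pow_succ' M, pow_succ t⁻¹, mul_comm (t⁻¹ ^ n), ← mul_assoc, mul_inv_cancel₀ ht.ne',
      one_mul]
  have hw0 : ∀ n j, 0 ≤ w n j := fun n j => mul_nonneg (by positivity) (hpow n j)
  refine ⟨∑ n ∈ Finset.range N, w n, fun j => ?_, fun j => ?_⟩
  · rw [Finset.sum_apply]
    refine lt_of_lt_of_le ?_ (Finset.single_le_sum (f := fun n => w n j) (fun n _ => hw0 n j)
      (Finset.mem_range.2 hN))
    simp [w]
  · have e : M *ᵥ (∑ n ∈ Finset.range N, w n) = t • ∑ n ∈ Finset.range N, w (n + 1) := by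
      rw [Matrix.mulVec_sum, Finset.smul_sum]
      exact Finset.sum_congr rfl fun n _ => hw n
    have e2 := Finset.sum_range_succ' w N
    rw [Finset.sum_range_succ] at e2
    have e3 := congrFun e2 j
    have hN2 : w N j ≤ 1 := by
      have : ((M ^ N) *ᵥ fun _ => (1 : ℝ)) j ≤ t ^ N := by
        simpa [Matrix.mulVec, dotProduct] using hN' j
      simp only [w, Pi.smul_apply, smul_eq_mul, inv_pow]
      rw [inv_mul_le_iff₀ (by positivity)]
      simpa using this
    have h0 : w 0 j = 1 := by simp [w]
    simp only [Pi.add_apply] at e3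
    rw [e, Pi.smul_apply, smul_eq_mul]
    exact mul_le_mul_of_nonneg_left (by linarith) ht.le

/-- Positivity spreads backwards along positive entries: a zero of $v$ at $a$ forces $v$ to vanish
wherever $a$ leads. -/
theorem Communicates.pos_of_superharmonic {M : Matrix S S ℝ} (hM : ∀ j k, 0 ≤ M j k)
    (hc : Communicates M) {v : S → ℝ} (hv : ∀ j, 0 ≤ v j) {k : S} (hk : 0 < v k) {t : ℝ}
    (h : ∀ j, (M *ᵥ v) j ≤ t * v j) (j : S) : 0 < v j := by
  induction hc j k using Relation.ReflTransGen.head_induction_on with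
  | refl => exact hk
  | @head a b hab _ ih =>
    refine lt_of_le_of_ne (hv a) fun h0 => ?_
    have h1 := h a
    rw [← h0, mul_zero] at h1
    have h2 : M a b * v b ≤ (M *ᵥ v) a :=
      Finset.single_le_sum (f := fun c => M a c * v c)
        (fun c _ => mul_nonneg (hM a c) (hv c)) (Finset.mem_univ b)
    have := mul_pos hab ih
    linarith

theorem spr_ne_top [Nonempty S] (B : Matrix S S ℂ) : spr B ≠ ⊤ := by
  obtain ⟨k, _, hk⟩ := spectrum.exists_nnnorm_eq_spectralRadius B
  rw [spr, ← hk]; exact ENNReal.coe_ne_top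

/-- Superharmonic vectors for factors slightly above $\rho$, normalised to the simplex, have a limit
point. It is nonzero, hence positive by irreducibility. An inequality suffices later, so no Perron
eigenvector is needed. -/
theorem Communicates.exists_superharmonic [Nonempty S] {M : Matrix S S ℝ}
    (hM : ∀ j k, 0 ≤ M j k) (hc : Communicates M) :
    ∃ v : S → ℝ, (∀ j, 0 < v j) ∧
      ∀ j, (M *ᵥ v) j ≤ (spr (M.map Complex.ofReal)).toReal * v j := by
  set ρ := (spr (M.map Complex.ofReal)).toReal with hρ
  have hρ0 : 0 ≤ ρ := ENNReal.toReal_nonneg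
  have hex : ∀ n : ℕ, ∃ q ∈ stdSimplex ℝ S, ∀ j, (M *ᵥ q) j ≤ (ρ + 1 / (n + 1)) * q j := by
    intro n
    have hpos : (0 : ℝ) < 1 / (n + 1) := by positivity
    have hlt : spr (M.map Complex.ofReal) < ENNReal.ofReal (ρ + 1 / (n + 1)) := by
      rw [ENNReal.lt_ofReal_iff_toReal_lt (spr_ne_top _)]
      linarith
    obtain ⟨q, hq, hq'⟩ := exists_superharmonic_of_spr_lt hM (by linarith) hlt
    have hs : 0 < ∑ j, q j := Finset.sum_pos (fun j _ => hq j) Finset.univ_nonempty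
    refine ⟨(∑ j, q j)⁻¹ • q, ⟨fun j => ?_, ?_⟩, fun j => ?_⟩
    · exact mul_nonneg (inv_nonneg.2 hs.le) (hq j).le
    · simp only [Pi.smul_apply, smul_eq_mul, ← Finset.mul_sum]
      exact inv_mul_cancel₀ hs.ne'
    · rw [Matrix.mulVec_smul, Pi.smul_apply, Pi.smul_apply, smul_eq_mul, smul_eq_mul,
        mul_left_comm]
      exact mul_le_mul_of_nonneg_left (hq' j) (inv_nonneg.2 hs.le)
  choose q hq hq' using hex
  obtain ⟨v, hv, φ, hφ, hlim⟩ := (isCompact_stdSimplex ℝ S).tendsto_subseq hq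
  have hle : ∀ j, (M *ᵥ v) j ≤ ρ * v j := by
    intro j
    have h1 : Tendsto (fun n => (M *ᵥ q (φ n)) j) atTop (𝓝 ((M *ᵥ v) j)) := by
      have : Continuous fun u : S → ℝ => (M *ᵥ u) j := by
        simp only [Matrix.mulVec, dotProduct]; fun_prop
      exact (this.tendsto v).comp hlim
    have h2 : Tendsto (fun n => (ρ + 1 / ((φ n : ℕ) + 1 : ℝ)) * q (φ n) j) atTop
        (𝓝 ((ρ + 0) * v j)) := by
      refine Tendsto.mul (tendsto_const_nhds.add ?_) ?_
      · exact tendsto_one_div_add_atTop_nhds_zero_nat.comp hφ.tendsto_atTop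
      · exact ((continuous_apply j).tendsto v).comp hlim
    rw [add_zero] at h2
    exact le_of_tendsto_of_tendsto' h1 h2 fun n => hq' (φ n) j
  have hk : ∃ k, 0 < v k := by
    by_contra! hcon
    have : ∑ j, v j ≤ 0 := Finset.sum_nonpos fun j _ => hcon j
    rw [hv.2] at this
    linarith
  obtain ⟨k, hk⟩ := hk
  exact ⟨v, hc.pos_of_superharmonic hM hv.1 hk hle, hle⟩

theorem exists_eigenvector_spr [Nonempty S] (B : Matrix S S ℂ) :
    ∃ (l : ℂ) (u : S → ℂ), u ≠ 0 ∧ B *ᵥ u = l • u ∧ spr B = ENNReal.ofReal ‖l‖ := by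
  obtain ⟨l, hl, hl'⟩ := spectrum.exists_nnnorm_eq_spectralRadius B
  rw [← Matrix.spectrum_toLin', ← Module.End.hasEigenvalue_iff_mem_spectrum] at hl
  obtain ⟨u, hu⟩ := hl.exists_hasEigenvector
  refine ⟨l, u, hu.2, ?_, ?_⟩
  · simpa using hu.apply_eq_smul
  · rw [spr, ← hl', ofReal_norm]; rfl

/-- The ratio of an eigenvector of a dominated matrix and a positive vector has a maximum,
and it is attained at some index. -/
theorem exists_max_ratio [Nonempty S] {v : S → ℝ} (hv : ∀ j, 0 < v j) {u : S → ℂ}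
    (hu : u ≠ 0) : ∃ c : ℝ, 0 < c ∧ (∀ j, ‖u j‖ ≤ c * v j) ∧ ∃ j, ‖u j‖ = c * v j := by
  obtain ⟨j, hj⟩ := Finite.exists_max fun j => ‖u j‖ / v j
  obtain ⟨i, hi⟩ := Function.ne_iff.1 hu
  refine ⟨‖u j‖ / v j, ?_, fun k => ?_, j, ?_⟩
  · exact lt_of_lt_of_le (div_pos (norm_pos_iff.2 hi) (hv i)) (hj i)
  · exact (div_le_iff₀ (hv k)).1 (hj k)
  · rw [div_mul_cancel₀ _ (hv j).ne']

theorem norm_eigen_le {B : Matrix S S ℂ} {l : ℂ} {u : S → ℂ} (hB : B *ᵥ u = l • u) (j : S) :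
    ‖l‖ * ‖u j‖ ≤ ∑ k, ‖B j k‖ * ‖u k‖ := by
  have : l * u j = ∑ k, B j k * u k := by
    have := congrFun hB j
    simpa [Matrix.mulVec, dotProduct] using this.symm
  rw [← norm_mul, this]
  refine (norm_sum_le _ _).trans (le_of_eq ?_)
  simp

/-- Maximum principle: evaluate the eigenvalue equation where $|u_j|/v_j$ is largest. -/
theorem spr_le_of_superharmonic [Nonempty S] {M : Matrix S S ℝ} {B : Matrix S S ℂ}
    (hBM : ∀ j k, ‖B j k‖ ≤ M j k) {v : S → ℝ} (hv : ∀ j, 0 < v j) {r : ℝ}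
    (h : ∀ j, (M *ᵥ v) j ≤ r * v j) : spr B ≤ ENNReal.ofReal r := by
  obtain ⟨l, u, hu, hl, hs⟩ := exists_eigenvector_spr B
  obtain ⟨c, hc, hle, j, hj⟩ := exists_max_ratio hv hu
  rw [hs]
  refine ENNReal.ofReal_le_ofReal ?_
  have h1 := norm_eigen_le hl j
  have h2 : ∑ k, ‖B j k‖ * ‖u k‖ ≤ ∑ k, M j k * (c * v k) :=
    Finset.sum_le_sum fun k _ => mul_le_mul (hBM j k) (hle k) (norm_nonneg _)
      ((norm_nonneg _).trans (hBM j k))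
  have h3 : ∑ k, M j k * (c * v k) = c * (M *ᵥ v) j := by
    simp only [Matrix.mulVec, dotProduct, Finset.mul_sum]
    exact Finset.sum_congr rfl fun k _ => by ring
  have h4 := mul_le_mul_of_nonneg_left (h j) hc.le
  rw [hj] at h1
  have h5 : ‖l‖ * (c * v j) ≤ r * (c * v j) := by linarith
  exact le_of_mul_le_mul_right h5 (mul_pos hc (hv j))

/-- A matrix dominated by an irreducible nonnegative matrix, strictly at one entry, has a strictly
smaller spectral radius. -/
theorem Communicates.spr_lt [Nonempty S] {M : Matrix S S ℝ} {B : Matrix S S ℂ}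
    (hc : Communicates M) (hBM : ∀ j k, ‖B j k‖ ≤ M j k) {a b : S} (hab : ‖B a b‖ < M a b) :
    spr B < spr (M.map Complex.ofReal) := by
  have hM : ∀ j k, 0 ≤ M j k := fun j k => (norm_nonneg _).trans (hBM j k)
  obtain ⟨v, hv, hle⟩ := hc.exists_superharmonic hM
  obtain ⟨l, u, hu, hl, hs⟩ := exists_eigenvector_spr B
  obtain ⟨c, hcpos, hu_le, i, hi⟩ := exists_max_ratio hv hu
  rw [hs, ENNReal.ofReal_lt_iff_lt_toReal (norm_nonneg _) (spr_ne_top _)]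
  set ρ := (spr (M.map Complex.ofReal)).toReal
  by_contra! hcon
  -- With $|l|\ge\rho$, all estimates at an index of maximal ratio collapse to equalities, term by
  -- term.
  have key : ∀ j, ‖u j‖ = c * v j → ∀ k, ‖B j k‖ * ‖u k‖ = M j k * (c * v k) := by
    intro j hj
    have h2 : ∀ k ∈ Finset.univ, ‖B j k‖ * ‖u k‖ ≤ M j k * (c * v k) :=
      fun k _ => mul_le_mul (hBM j k) (hu_le k) (norm_nonneg _) (hM j k)
    have h3 : ∑ k, M j k * (c * v k) = c * (M *ᵥ v) j := by
      simp only [Matrix.mulVec, dotProduct, Finset.mul_sum]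
      exact Finset.sum_congr rfl fun k _ => by ring
    have h1 := norm_eigen_le hl j
    have h4 := mul_le_mul_of_nonneg_left (hle j) hcpos.le
    rw [hj] at h1
    have h5 := mul_le_mul_of_nonneg_right hcon (mul_pos hcpos (hv j)).le
    have h6 : ∑ k, ‖B j k‖ * ‖u k‖ = ∑ k, M j k * (c * v k) :=
      le_antisymm (Finset.sum_le_sum h2) (by linarith)
    exact fun k => (Finset.sum_eq_sum_iff_of_le h2).1 h6 k (Finset.mem_univ k)
  -- By `key`, a positive entry `M p q` carries maximality of the ratio from `p` to `q`.
  have hall : ∀ j, ‖u j‖ = c * v j := by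
    intro j
    induction hc i j with
    | refl => exact hi
    | @tail p q _ hpq ih =>
      refine le_antisymm (hu_le q) ?_
      have h1 := key p ih q
      have h2 : ‖B p q‖ * ‖u q‖ ≤ M p q * ‖u q‖ :=
        mul_le_mul_of_nonneg_right (hBM p q) (norm_nonneg _)
      exact le_of_mul_le_mul_left (h1 ▸ h2) hpq
  have h1 := key a (hall a) b
  rw [hall b] at h1
  exact hab.ne (mul_right_cancel₀ (mul_pos hcpos (hv b)).ne' h1)

end Perron

/-! ### First-passage sums: recursion, domination and convergence. -/

section Descent

/-- The sum of the products `A i₁ * ⋯ * A iₙ` over the sequences of steps in `{-1, 0, 1}` that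
lead from height `h` to height `0` for the first time at time `n`, by recursion on the first
step. -/
def descent {R : Type*} [Semiring R] (A : ℤ → R) : ℕ → ℕ → R
  | 0, 0 => 1
  | 0, _ + 1 => 0
  | _ + 1, 0 => 0
  | n + 1, h + 1 => A (-1) * descent A n h + A 0 * descent A n (h + 1) + A 1 * descent A n (h + 2)

/-- The sequence of steps `i` leads from height `h` to height `0`, not earlier than at its end. -/
def HitsZero {n : ℕ} (h : ℤ) (i : Fin n → ℤ) : Prop :=
  (∀ k < n, 0 < h + ∑ l with l.val < k, i l) ∧ h + ∑ l, i l = 0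

/-- Starting at height one turns nonnegative partial sums into positive heights; the extra condition
at `k = 0` is automatic. -/
theorem isDown_iff_hitsZero {n : ℕ} (i : Fin n → ℤ) : IsDown i ↔ HitsZero 1 i := by
  refine and_congr ⟨fun h k hk => ?_, fun h k _ hk => ?_⟩ ⟨fun h => by rw [h]; rfl, fun h => ?_⟩
  · rcases Nat.eq_zero_or_pos k with rfl | hk0
    · simp
    · have := h k hk0 hk
      omega
  · have := h k hk
    omega
  · omega

theorem hitsZero_cons {n : ℕ} (h a : ℤ) (i : Fin n → ℤ) :
    HitsZero h (Fin.cons a i : Fin (n + 1) → ℤ) ↔ 0 < h ∧ HitsZero (h + a) i := by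
  have hs : ∀ k, ∑ l : Fin (n + 1) with l.val < k + 1, (Fin.cons a i : Fin (n + 1) → ℤ) l =
      a + ∑ l : Fin n with l.val < k, i l := by
    intro k
    simp [Finset.sum_filter, Fin.sum_univ_succ]
  unfold HitsZero
  rw [Fin.sum_univ_succ]
  simp only [Fin.cons_zero, Fin.cons_succ, ← add_assoc]
  constructor
  · rintro ⟨h1, h2⟩
    refine ⟨by simpa using h1 0 (Nat.succ_pos n), fun k hk => ?_, h2⟩
    have := h1 (k + 1) (by omega)
    rw [hs] at this
    omega
  · rintro ⟨h0, h1, h2⟩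
    refine ⟨fun k hk => ?_, h2⟩
    rcases k with _ | k
    · simpa using h0
    · have := h1 k (by omega)
      rw [hs]
      omega

theorem sum_piFinset_cons {R : Type*} [AddCommMonoid R] (n : ℕ) (f : (Fin (n + 1) → ℤ) → R) :
    ∑ i ∈ Fintype.piFinset (fun _ : Fin (n + 1) => H), f i =
      ∑ a ∈ H, ∑ i ∈ Fintype.piFinset (fun _ : Fin n => H), f (Fin.cons a i) := by
  rw [← Finset.sum_product']
  refine Finset.sum_nbij' (fun i => (i 0, Fin.tail i)) (fun p => Fin.cons p.1 p.2) ?_ ?_ ?_ ?_ ?_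
  · intro i hi
    simp only [Fintype.mem_piFinset, Finset.mem_product] at hi ⊢
    exact ⟨hi 0, fun l => hi l.succ⟩
  · rintro ⟨a, i⟩ hp
    simp only [Fintype.mem_piFinset, Finset.mem_product] at hp ⊢
    intro l
    refine Fin.cases ?_ (fun l => ?_) l
    · simpa using hp.1
    · simpa using hp.2 l
  · intro i _; exact Fin.cons_self_tail i
  · rintro ⟨a, i⟩ _; simp
  · intro i _; simp

theorem sum_H {R : Type*} [AddCommMonoid R] (f : ℤ → R) :
    ∑ k ∈ H, f k = f (-1) + f 0 + f 1 := by
  have : H = {-1, 0, 1} := rfl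
  rw [this, Finset.sum_insert (by decide), Finset.sum_insert (by decide), Finset.sum_singleton,
    add_assoc]

theorem mem_H {k : ℤ} : k ∈ H ↔ k = -1 ∨ k = 0 ∨ k = 1 := by
  rw [H, Finset.mem_Icc]; omega

theorem mem_HPlus {k : ℤ} : k ∈ HPlus ↔ k = 0 ∨ k = 1 := by
  rw [HPlus, Finset.mem_Icc]; omega

-- Conditioning on the first step replaces path sets by the recursion `descent`; all starting
-- heights are needed for the induction.
open Classical in
theorem sum_hitsZero {R : Type*} [Semiring R] (A : ℤ → R) (n h : ℕ) :
    ∑ i ∈ (Fintype.piFinset fun _ : Fin n => H) with HitsZero (h : ℤ) i,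
      (List.ofFn fun l => A (i l)).prod = descent A n h := by
  induction n generalizing h with
  | zero =>
    rw [Finset.sum_filter]
    rcases h with _ | h
    · simp [HitsZero, descent]
    · have : ((h : ℤ) + 1) ≠ 0 := by omega
      simp [HitsZero, descent, this]
  | succ n ih =>
    rw [Finset.sum_filter, sum_piFinset_cons]
    simp only [hitsZero_cons, List.ofFn_succ, Fin.cons_zero, Fin.cons_succ, List.prod_cons]
    rcases h with _ | h
    · simp [descent]
    · have key : ∀ (a : ℤ) (h' : ℕ), (h' : ℤ) = (h + 1 : ℕ) + a →
          ∑ i ∈ Fintype.piFinset (fun _ : Fin n => H),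
            (if 0 < ((h + 1 : ℕ) : ℤ) ∧ HitsZero (((h + 1 : ℕ) : ℤ) + a) i then
              A a * (List.ofFn fun l => A (i l)).prod else 0) = A a * descent A n h' := by
        intro a h' hh
        rw [← ih h', Finset.sum_filter, Finset.mul_sum, ← hh]
        refine Finset.sum_congr rfl fun i _ => ?_
        have : 0 < ((h + 1 : ℕ) : ℤ) := by omega
        simp only [this, true_and, mul_ite, mul_zero]
      rw [sum_H, key (-1) h (by push_cast; ring), key 0 (h + 1) (by simp),
        key 1 (h + 2) (by push_cast; ring), descent]

theorem map_descent {R R' : Type*} [Semiring R] [Semiring R'] (f : R →+* R') (A : ℤ → R)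
    (n h : ℕ) : f (descent A n h) = descent (fun k => f (A k)) n h := by
  induction n generalizing h with
  | zero => rcases h with _ | h <;> simp [descent]
  | succ n ih => rcases h with _ | h <;> simp [descent, ih]

variable {S : Type*} [Fintype S] [DecidableEq S]

theorem Model.D1_eq_descent (Q : Model S) (n : ℕ) (z : ℂ) :
    Q.D1 n z = descent (fun k => Q.AStar k z) n 1 := by
  rw [← sum_hitsZero, Model.D1, downSeq]
  refine Finset.sum_congr ?_ fun _ _ => rfl
  ext i
  simp [isDown_iff_hitsZero]

/-- The complex matrix `B` is dominated by the real matrix `M`. -/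
def Dominated (B : Matrix S S ℂ) (M : Matrix S S ℝ) : Prop :=
  ∀ j k, ‖B j k‖ ≤ M j k

theorem Dominated.add {B B' : Matrix S S ℂ} {M M' : Matrix S S ℝ} (h : Dominated B M)
    (h' : Dominated B' M') : Dominated (B + B') (M + M') :=
  fun j k => (norm_add_le _ _).trans (add_le_add (h j k) (h' j k))

theorem Dominated.mul {B B' : Matrix S S ℂ} {M M' : Matrix S S ℝ} (h : Dominated B M)
    (h' : Dominated B' M') : Dominated (B * B') (M * M') := by
  intro j k
  rw [Matrix.mul_apply, Matrix.mul_apply]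
  refine (norm_sum_le _ _).trans (Finset.sum_le_sum fun l _ => ?_)
  rw [norm_mul]
  exact mul_le_mul (h j l) (h' l k) (norm_nonneg _) ((norm_nonneg _).trans (h j l))

theorem Dominated.descent {A : ℤ → Matrix S S ℂ} {A' : ℤ → Matrix S S ℝ}
    (h : ∀ k ∈ H, Dominated (A k) (A' k)) (n l : ℕ) :
    Dominated (descent A n l) (descent A' n l) := by
  induction n generalizing l with
  | zero =>
    rcases l with _ | l
    · intro j k
      rcases eq_or_ne j k with rfl | hjk
      · simp [TwoDQBD.descent]
      · simp [TwoDQBD.descent, Matrix.one_apply_ne hjk]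
    · intro j k; simp [TwoDQBD.descent]
  | succ n ih =>
    rcases l with _ | l
    · intro j k; simp [TwoDQBD.descent]
    · exact (((h _ (by decide)).mul (ih _)).add ((h _ (by decide)).mul (ih _))).add
        ((h _ (by decide)).mul (ih _))

theorem Dominated.nonneg {B : Matrix S S ℂ} {M : Matrix S S ℝ} (h : Dominated B M) (j k : S) :
    0 ≤ M j k := (norm_nonneg _).trans (h j k)

/-- If `v` is superharmonic for `y⁻¹ A₋₁ + A₀ + y A₁`, the expected value of `v` at the time of
the first visit to height `0` is at most `y ^ h` times `v`. -/
theorem sum_descent_mulVec_le {A : ℤ → Matrix S S ℝ} (hA : ∀ k ∈ H, ∀ a b, 0 ≤ A k a b)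
    {y : ℝ} (hy : 0 < y) {v : S → ℝ} (hv : ∀ j, 0 ≤ v j)
    (h : ∀ j, ((∑ k ∈ H, y ^ k • A k) *ᵥ v) j ≤ v j) (N l : ℕ) (j : S) :
    ((∑ n ∈ Finset.range N, descent A n l) *ᵥ v) j ≤ y ^ l * v j := by
  have hmono : ∀ {M : Matrix S S ℝ}, (∀ a b, 0 ≤ M a b) → ∀ {u w : S → ℝ}, (∀ j, u j ≤ w j) →
      ∀ j, (M *ᵥ u) j ≤ (M *ᵥ w) j := fun hM u w huw j =>
    Finset.sum_le_sum fun k _ => mul_le_mul_of_nonneg_left (huw k) (hM j k)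
  induction N generalizing l j with
  | zero => simp only [Finset.range_zero, Finset.sum_empty, Matrix.zero_mulVec, Pi.zero_apply]
            exact mul_nonneg (by positivity) (hv j)
  | succ N ih =>
    rw [Finset.sum_range_succ']
    rcases l with _ | l
    · simp [descent]
    · simp only [descent, add_zero, Finset.sum_add_distrib, ← Finset.mul_sum,
        Matrix.add_mulVec, Pi.add_apply, ← Matrix.mulVec_mulVec]
      have e : ∀ (k : ℤ) (_ : k ∈ H) (m : ℕ), (m : ℤ) = (l + 1 : ℕ) + k →
          (A k *ᵥ ((∑ n ∈ Finset.range N, descent A n m) *ᵥ v)) j ≤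
            y ^ (l + 1) * ((y ^ k • A k) *ᵥ v) j := by
        intro k hk m hm
        refine (hmono (hA k hk) (w := (y ^ m) • v) (fun i => ih m i) j).trans (le_of_eq ?_)
        rw [Matrix.mulVec_smul, Matrix.smul_mulVec, Pi.smul_apply, Pi.smul_apply, smul_eq_mul,
          smul_eq_mul, ← mul_assoc, ← zpow_natCast, hm, zpow_add₀ hy.ne', zpow_natCast]
      have h1 := e (-1) (by decide) l (by push_cast; ring)
      have h2 := e 0 (by decide) (l + 1) (by simp)
      have h3 := e 1 (by decide) (l + 2) (by push_cast; ring)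
      have h4 := mul_le_mul_of_nonneg_left (h j) (pow_pos hy (l + 1)).le
      rw [sum_H, Matrix.add_mulVec, Matrix.add_mulVec, Pi.add_apply, Pi.add_apply] at h4
      linarith

/-- The terms are nonnegative, and their partial sums at $(j,k)$ are at most $y^l v_j/v_k$ because
$v_k>0$. -/
theorem summable_descent {A : ℤ → Matrix S S ℝ} (hA : ∀ k ∈ H, ∀ a b, 0 ≤ A k a b)
    {y : ℝ} (hy : 0 < y) {v : S → ℝ} (hv : ∀ j, 0 < v j)
    (h : ∀ j, ((∑ k ∈ H, y ^ k • A k) *ᵥ v) j ≤ v j) (l : ℕ) (j k : S) :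
    Summable fun n => descent A n l j k := by
  have hnn : ∀ n a b, 0 ≤ descent A n l a b := fun n =>
    (Dominated.descent (A := fun k => (A k).map Complex.ofReal) (fun k hk a b => by
      simp [abs_of_nonneg (hA k hk a b)]) n l).nonneg
  refine summable_of_sum_range_le (c := y ^ l * v j / v k) (fun n => hnn n j k) fun N => ?_
  rw [le_div_iff₀ (hv k), ← Matrix.sum_apply]
  refine le_trans ?_ (sum_descent_mulVec_le hA hy (fun i => (hv i).le) h N l j)
  refine Finset.single_le_sum
    (f := fun b => (∑ n ∈ Finset.range N, descent A n l) j b * v b) (fun b _ => ?_)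
    (Finset.mem_univ k)
  rw [Matrix.sum_apply]
  exact mul_nonneg (Finset.sum_nonneg fun n _ => hnn n j b) (hv b).le

end Descent

/-! ### Domination that remembers one monomial, and the equality case of the triangle inequality. -/

section Term

/-- The real number `b` dominates the complex number `a`, and `a` has a term `c z ^ m` with `c > 0`
that `b` dominates by the term `c ‖z‖ ^ m`. -/
def HasTerm (z : ℂ) (a : ℂ) (b : ℝ) (m : ℤ) : Prop :=
  ∃ c : ℝ, 0 < c ∧ ‖a - c * z ^ m‖ ≤ b - c * ‖z‖ ^ m

variable {z : ℂ}

theorem HasTerm.norm_le {a : ℂ} {b : ℝ} {m : ℤ} (h : HasTerm z a b m) : ‖a‖ ≤ b := by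
  obtain ⟨c, hc, h⟩ := h
  have h1 : ‖(c : ℂ) * z ^ m‖ = c * ‖z‖ ^ m := by simp [abs_of_pos hc]
  have h2 := norm_add_le (a - c * z ^ m) (c * z ^ m)
  rw [sub_add_cancel] at h2
  linarith

theorem HasTerm.pos (hz : z ≠ 0) {a : ℂ} {b : ℝ} {m : ℤ} (h : HasTerm z a b m) : 0 < b := by
  obtain ⟨c, hc, h⟩ := h
  have := norm_nonneg (a - c * z ^ m)
  have h2 : 0 < c * ‖z‖ ^ m := mul_pos hc (zpow_pos (norm_pos_iff.2 hz) m)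
  linarith

theorem HasTerm.add_right {a a' : ℂ} {b b' : ℝ} {m : ℤ} (h : HasTerm z a b m) (h' : ‖a'‖ ≤ b') :
    HasTerm z (a + a') (b + b') m := by
  obtain ⟨c, hc, h⟩ := h
  refine ⟨c, hc, ?_⟩
  rw [add_sub_right_comm]
  exact (norm_add_le _ _).trans (by linarith)

theorem HasTerm.add_left {a a' : ℂ} {b b' : ℝ} {m : ℤ} (h : HasTerm z a b m) (h' : ‖a'‖ ≤ b') :
    HasTerm z (a' + a) (b' + b) m := by
  rw [add_comm a', add_comm b']; exact h.add_right h'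

theorem HasTerm.mul (hz : z ≠ 0) {a a' : ℂ} {b b' : ℝ} {m m' : ℤ} (h : HasTerm z a b m)
    (h' : HasTerm z a' b' m') : HasTerm z (a * a') (b * b') (m + m') := by
  have hb := h'.norm_le
  obtain ⟨c, hc, h⟩ := h
  obtain ⟨c', hc', h'⟩ := h'
  refine ⟨c * c', mul_pos hc hc', ?_⟩
  have h1 : ‖(c : ℂ) * z ^ m‖ = c * ‖z‖ ^ m := by simp [abs_of_pos hc]
  have e : a * a' - ((c * c' : ℝ) : ℂ) * z ^ (m + m') =
      (a - c * z ^ m) * a' + c * z ^ m * (a' - c' * z ^ m') := by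
    rw [zpow_add₀ hz]; push_cast; ring
  rw [e, zpow_add₀ (norm_ne_zero_iff.2 hz)]
  refine (norm_add_le _ _).trans ?_
  rw [norm_mul, norm_mul (_ * _), h1]
  have h2 := mul_le_mul h hb (norm_nonneg _) ((norm_nonneg _).trans h)
  have h3 := mul_le_mul_of_nonneg_left h' (h1 ▸ norm_nonneg ((c : ℂ) * z ^ m))
  linarith

theorem HasTerm.sum {ι : Type*} [DecidableEq ι] {s : Finset ι} {a : ι → ℂ} {b : ι → ℝ} {m : ℤ}
    {i : ι} (hi : i ∈ s) (h : HasTerm z (a i) (b i) m) (hab : ∀ j ∈ s, ‖a j‖ ≤ b j) :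
    HasTerm z (∑ j ∈ s, a j) (∑ j ∈ s, b j) m := by
  rw [← Finset.add_sum_erase _ a hi, ← Finset.add_sum_erase _ b hi]
  exact h.add_right (norm_sum_le_of_le _ fun j hj => hab j (Finset.mem_of_mem_erase hj))

theorem HasTerm.tsum {a : ℕ → ℂ} {b : ℕ → ℝ} {m : ℤ} {i : ℕ} (h : HasTerm z (a i) (b i) m)
    (hab : ∀ j, ‖a j‖ ≤ b j) (hb : Summable b) : HasTerm z (∑' j, a j) (∑' j, b j) m := by
  have ha : Summable a := hb.of_norm_bounded hab
  rw [ha.tsum_eq_add_tsum_ite i, hb.tsum_eq_add_tsum_ite i]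
  refine h.add_right (tsum_of_norm_bounded (Summable.hasSum ?_) fun j => ?_)
  · refine Summable.of_nonneg_of_le (fun j => ?_) (fun j => ?_) hb <;>
    have := (norm_nonneg _).trans (hab j) <;> split_ifs <;> simp [this]
  · split_ifs
    · simp
    · exact hab j

/-- Terms with consecutive exponents force a strict inequality, as `z` is not positive. -/
theorem HasTerm.norm_lt (hz0 : z ≠ 0) (hz : z ≠ (‖z‖ : ℝ)) {a : ℂ} {b : ℝ} {m : ℤ}
    (h : HasTerm z a b m) (h' : HasTerm z a b (m + 1)) : ‖a‖ < b := by
  refine lt_of_le_of_ne h.norm_le fun hab => hz ?_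
  -- If $|a|=b$, then $a-cz^m$ and $cz^m$ attain equality in the triangle inequality, so $a$ lies on
  -- the ray of $z^m$. Comparing two consecutive exponents gives $z=|z|$.
  have key : ∀ m, HasTerm z a b m → (‖z‖ ^ m : ℝ) * a = (‖a‖ : ℂ) * z ^ m := by
    rintro m ⟨c, hc, h⟩
    have h1 : ‖(c : ℂ) * z ^ m‖ = c * ‖z‖ ^ m := by simp [abs_of_pos hc]
    have h2 := norm_add_le (a - c * z ^ m) (c * z ^ m)
    rw [sub_add_cancel] at h2
    have h3 : SameRay ℝ (a - c * z ^ m) (c * z ^ m) := by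
      rw [sameRay_iff_norm_add, sub_add_cancel]; linarith
    have h4 : SameRay ℝ a (c * z ^ m) := by
      have := h3.add_left (SameRay.refl ((c : ℂ) * z ^ m))
      rwa [sub_add_cancel] at this
    have h5 := h4.norm_smul_eq
    rw [h1] at h5
    simp only [Complex.real_smul] at h5
    have hc' : (c : ℂ) ≠ 0 := by exact_mod_cast hc.ne'
    refine mul_left_cancel₀ hc' ?_
    push_cast at h5 ⊢
    linear_combination -h5
  have h1 := key _ h
  have h2 := key _ h'
  have hb := h.pos hz0
  have hn : (‖z‖ : ℂ) ≠ 0 := by exact_mod_cast norm_ne_zero_iff.2 hz0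
  have ha : (‖a‖ : ℂ) ≠ 0 := by rw [hab]; exact_mod_cast hb.ne'
  push_cast at h1 h2
  rw [zpow_add_one₀ hz0, zpow_add_one₀ hn] at h2
  have h3 : (‖a‖ : ℂ) * z ^ m * (‖z‖ : ℂ) = (‖a‖ : ℂ) * z ^ m * z := by
    linear_combination h2 - ‖z‖ * h1
  exact (mul_left_cancel₀ (mul_ne_zero ha (zpow_ne_zero m hz0)) h3).symm

end Term

/-! ### From irreducible chains to paths of positive steps. -/

section Paths

variable {E : Type*} [DecidableEq E]

theorem nStep_nonneg {p : E → E → ℝ} (hp : ∀ x y, 0 ≤ p x y) (n : ℕ) (x y : E) :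
    0 ≤ nStep p n x y := by
  induction n generalizing x with
  | zero => simp only [nStep]; split_ifs <;> simp
  | succ n ih => exact tsum_nonneg fun w => mul_nonneg (hp x w) (ih w)

theorem reflTransGen_of_nStep_pos {p : E → E → ℝ} (hp : ∀ x y, 0 ≤ p x y) {n : ℕ} {x y : E}
    (h : 0 < nStep p n x y) : Relation.ReflTransGen (fun a b => 0 < p a b) x y := by
  induction n generalizing x with
  | zero =>
    rcases eq_or_ne x y with rfl | hxy
    · exact .refl
    · simp [nStep, hxy] at h
  | succ n ih =>
    obtain ⟨w, hw⟩ : ∃ w, p x w * nStep p n w y ≠ 0 := by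
      by_contra! hcon
      simp [nStep, hcon] at h
    have h1 := lt_of_le_of_ne (hp x w) (left_ne_zero_of_mul hw).symm
    have h2 := lt_of_le_of_ne (nStep_nonneg hp n w y) (right_ne_zero_of_mul hw).symm
    exact .head h1 (ih h2)

theorem IsIrreducibleChain.reflTransGen {p : E → E → ℝ} (hp : ∀ x y, 0 ≤ p x y)
    (h : IsIrreducibleChain p) (x y : E) :
    Relation.ReflTransGen (fun a b => 0 < p a b) x y :=
  let ⟨_, hn⟩ := h x y
  reflTransGen_of_nStep_pos hp hn

end Paths

/-! ### Positive steps of the chains, and the convex geometry of `GammaBar`. -/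

namespace Model

variable {S : Type*} [Fintype S] [DecidableEq S] (Q : Model S)

theorem pFree_nonneg (x y : ℤ × ℤ × S) : 0 ≤ Q.pFree x y := by
  unfold pFree
  split_ifs with h
  · exact Q.A_nonneg _ h.1 _ h.2 _ _
  · rfl

theorem pOne_nonneg (x y : ℤ × ℕ × S) : 0 ≤ Q.pOne x y := by
  unfold pOne
  split_ifs with h h'
  · exact Q.A_nonneg _ h.2.1 _ h.2.2 _ _
  · exact Q.A1_nonneg _ h'.2.1 _ h'.2.2 _ _
  · rfl

theorem pFree_pos {x y : ℤ × ℤ × S} (h : 0 < Q.pFree x y) :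
    ∃ i ∈ H, ∃ k ∈ H, y.1 = x.1 + i ∧ y.2.1 = x.2.1 + k ∧ 0 < Q.A i k x.2.2 y.2.2 := by
  unfold pFree at h
  split_ifs at h with h'
  · exact ⟨_, h'.1, _, h'.2, by ring, by ring, h⟩
  · exact absurd h (lt_irrefl 0)

theorem pOne_pos {x y : ℤ × ℕ × S} (h : 0 < Q.pOne x y) :
    (x.2.1 ≠ 0 ∧ ∃ i ∈ H, ∃ k ∈ H, y.1 = x.1 + i ∧ (y.2.1 : ℤ) = x.2.1 + k ∧
      0 < Q.A i k x.2.2 y.2.2) ∨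
    (x.2.1 = 0 ∧ ∃ i ∈ H, ∃ k ∈ HPlus, y.1 = x.1 + i ∧ (y.2.1 : ℤ) = k ∧
      0 < Q.A1 i k x.2.2 y.2.2) := by
  unfold pOne at h
  split_ifs at h with h1 h2
  · exact .inl ⟨h1.1, _, h1.2.1, _, h1.2.2, by ring, by ring, h⟩
  · exact .inr ⟨h2.1, _, h2.2.1, _, h2.2.2, by ring, by rw [h2.1]; simp, h⟩
  · exact absurd h (lt_irrefl 0)

/-- The matrix `C (x, y)` for real arguments. -/
noncomputable def realC (x y : ℝ) : Matrix S S ℝ := ∑ i ∈ H, ∑ k ∈ H, (x ^ i * y ^ k) • Q.A i k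

theorem C_ofReal (x y : ℝ) : Q.C x y = (Q.realC x y).map Complex.ofReal := by
  ext a b
  simp [C, realC, Matrix.sum_apply]

theorem realC_nonneg {x y : ℝ} (hx : 0 < x) (hy : 0 < y) (a b : S) : 0 ≤ Q.realC x y a b := by
  simp only [realC, Matrix.sum_apply, Matrix.smul_apply, smul_eq_mul]
  exact Finset.sum_nonneg fun i hi => Finset.sum_nonneg fun k hk =>
    mul_nonneg (by positivity) (Q.A_nonneg i hi k hk a b)

theorem realC_pos {x y : ℝ} (hx : 0 < x) (hy : 0 < y) {i k : ℤ} (hi : i ∈ H) (hk : k ∈ H)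
    {a b : S} (h : 0 < Q.A i k a b) : 0 < Q.realC x y a b := by
  simp only [realC, Matrix.sum_apply, Matrix.smul_apply, smul_eq_mul]
  have hnn : ∀ i ∈ H, ∀ k ∈ H, 0 ≤ x ^ i * y ^ k * Q.A i k a b := fun i hi k hk =>
    mul_nonneg (by positivity) (Q.A_nonneg i hi k hk a b)
  exact Finset.sum_pos' (fun i hi => Finset.sum_nonneg (hnn i hi))
    ⟨i, hi, Finset.sum_pos' (hnn i hi) ⟨k, hk, by positivity⟩⟩

variable {Q}

theorem IrreducibleAperiodic.free_path (hQ : Q.IrreducibleAperiodic) (x y : ℤ × ℤ × S) :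
    Relation.ReflTransGen (fun a b => 0 < Q.pFree a b) x y :=
  hQ.free_irreducible.reflTransGen Q.pFree_nonneg x y

theorem IrreducibleAperiodic.one_path (hQ : Q.IrreducibleAperiodic) (x y : ℤ × ℕ × S) :
    Relation.ReflTransGen (fun a b => 0 < Q.pOne a b) x y :=
  hQ.one_irreducible.reflTransGen Q.pOne_nonneg x y

theorem IrreducibleAperiodic.communicates_realC (hQ : Q.IrreducibleAperiodic) {x y : ℝ}
    (hx : 0 < x) (hy : 0 < y) : Communicates (Q.realC x y) := fun j k =>
  (hQ.free_path (0, 0, j) (0, 0, k)).lift (fun p => p.2.2) fun _ _ hab =>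
    let ⟨_, hi, _, hk, _, _, hA⟩ := Q.pFree_pos hab
    Q.realC_pos hx hy hi hk hA

variable (Q)

/-- The row sums of `C (e^{s₁}, e^{s₂})` conjugated by the diagonal matrix with entries `e^g`. -/
noncomputable def tiltedRowSum (p : ℝ × ℝ × (S → ℝ)) (j : S) : ℝ :=
  ∑ i ∈ H, ∑ k ∈ H, ∑ j', Q.A i k j j' *
    Real.exp (i * p.1 + k * p.2.1 + p.2.2 j' - p.2.2 j)

/-- Hence tilted row sums at most one mean exactly that $e^g$ is superharmonic for
$C(e^{s_1},e^{s_2})$. -/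
theorem tiltedRowSum_eq (p : ℝ × ℝ × (S → ℝ)) (j : S) :
    Q.tiltedRowSum p j = Real.exp (-p.2.2 j) *
      (Q.realC (Real.exp p.1) (Real.exp p.2.1) *ᵥ fun j' => Real.exp (p.2.2 j')) j := by
  simp only [tiltedRowSum, realC, Matrix.sum_mulVec, Finset.sum_apply, Finset.mul_sum,
    Matrix.smul_mulVec, Pi.smul_apply, smul_eq_mul]
  simp only [Matrix.mulVec, dotProduct, Finset.mul_sum]
  refine Finset.sum_congr rfl fun i _ => Finset.sum_congr rfl fun k _ =>
    Finset.sum_congr rfl fun j' _ => ?_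
  rw [← Real.rpow_intCast, ← Real.rpow_intCast, ← Real.exp_mul, ← Real.exp_mul, mul_comm p.1,
    mul_comm p.2.1, sub_eq_add_neg, Real.exp_add, Real.exp_add,
    Real.exp_add]
  ring

/-- The exponents of the points of `GammaBar` with the logarithms of a superharmonic vector,
normalised at `o`. -/
def tiltSet (o : S) : Set (ℝ × ℝ × (S → ℝ)) :=
  {p | p.2.2 o = 0 ∧ ∀ j, Q.tiltedRowSum p j ≤ 1}

/-- Each term is a nonnegative multiple of the exponential of a linear form; this is why the vector
is recorded by its logarithm. -/
theorem convex_tiltSet (o : S) : Convex ℝ (Q.tiltSet o) := by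
  rintro p ⟨hp0, hp⟩ q ⟨hq0, hq⟩ a b ha hb hab
  refine ⟨by simp [hp0, hq0], fun j => ?_⟩
  calc Q.tiltedRowSum (a • p + b • q) j
      ≤ a * Q.tiltedRowSum p j + b * Q.tiltedRowSum q j := by
        simp only [tiltedRowSum, Finset.mul_sum, ← Finset.sum_add_distrib]
        refine Finset.sum_le_sum fun i hi => Finset.sum_le_sum fun k hk =>
          Finset.sum_le_sum fun j' _ => ?_
        have h := convexOn_exp.2 (Set.mem_univ (i * p.1 + k * p.2.1 + p.2.2 j' - p.2.2 j))
          (Set.mem_univ (i * q.1 + k * q.2.1 + q.2.2 j' - q.2.2 j)) ha hb hab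
        simp only [smul_eq_mul] at h
        have h' := mul_le_mul_of_nonneg_left h (Q.A_nonneg i hi k hk j j')
        refine le_trans (le_of_eq ?_) (h'.trans (le_of_eq (by ring)))
        congr 2
        simp
        ring
    _ ≤ a * 1 + b * 1 := add_le_add (mul_le_mul_of_nonneg_left (hp j) ha)
        (mul_le_mul_of_nonneg_left (hq j) hb)
    _ = 1 := by rw [mul_one, mul_one, hab]

theorem isClosed_tiltSet (o : S) : IsClosed (Q.tiltSet o) := by
  have h : Q.tiltSet o = {p | p.2.2 o = 0} ∩ ⋂ j, {p | Q.tiltedRowSum p j ≤ 1} := by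
    ext p; simp [tiltSet]
  rw [h]
  refine (isClosed_eq (by fun_prop) continuous_const).inter
    (isClosed_iInter fun j => isClosed_le ?_ continuous_const)
  unfold tiltedRowSum
  fun_prop

variable {Q}

/-- Every single term of a row sum is at most one, so its logarithm bounds the tilt of that step by
$-\log A$. These bounds add up along a path. -/
theorem exists_tilt_bound {x y : ℤ × ℤ × S}
    (h : Relation.ReflTransGen (fun a b => 0 < Q.pFree a b) x y) :
    ∃ c : ℝ, ∀ p : ℝ × ℝ × (S → ℝ), (∀ j, Q.tiltedRowSum p j ≤ 1) →
      (y.1 - x.1) * p.1 + (y.2.1 - x.2.1) * p.2.1 + p.2.2 y.2.2 - p.2.2 x.2.2 ≤ c := by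
  induction h with
  | refl => exact ⟨0, fun p _ => by simp⟩
  | @tail y w _ hyw ih =>
    obtain ⟨c, hc⟩ := ih
    obtain ⟨i, hi, k, hk, h1, h2, hA⟩ := Q.pFree_pos hyw
    refine ⟨c - Real.log (Q.A i k y.2.2 w.2.2), fun p hp => ?_⟩
    have hnn : ∀ i ∈ H, ∀ k ∈ H, ∀ j', 0 ≤ Q.A i k y.2.2 j' *
        Real.exp (i * p.1 + k * p.2.1 + p.2.2 j' - p.2.2 y.2.2) := fun i hi k hk j' =>
      mul_nonneg (Q.A_nonneg i hi k hk _ _) (Real.exp_pos _).le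
    have h3 : Q.A i k y.2.2 w.2.2 *
        Real.exp (i * p.1 + k * p.2.1 + p.2.2 w.2.2 - p.2.2 y.2.2) ≤ 1 := by
      refine le_trans ?_ (hp y.2.2)
      refine (Finset.single_le_sum (fun j' _ => hnn i hi k hk j') (Finset.mem_univ w.2.2)).trans ?_
      refine (Finset.single_le_sum (f := fun k => ∑ j', Q.A i k y.2.2 j' *
        Real.exp (i * p.1 + k * p.2.1 + p.2.2 j' - p.2.2 y.2.2))
        (fun k hk => Finset.sum_nonneg fun j' _ => hnn i hi k hk j') hk).trans ?_
      exact Finset.single_le_sum (f := fun i : ℤ => ∑ k ∈ H, ∑ j', Q.A i k y.2.2 j' *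
        Real.exp (i * p.1 + k * p.2.1 + p.2.2 j' - p.2.2 y.2.2))
        (fun i hi => Finset.sum_nonneg fun k hk => Finset.sum_nonneg fun j' _ => hnn i hi k hk j') hi
    have h4 := Real.log_le_log (by positivity) h3
    rw [Real.log_mul hA.ne' (Real.exp_pos _).ne', Real.log_exp, Real.log_one] at h4
    have h5 := hc p hp
    rw [h1, h2]
    push_cast
    linarith

/-- Paths moving one unit in each of the four directions bound $\pm s_1,\pm s_2$; paths between $o$
and $j$ bound $\pm g_j$, since $g_o=0$. -/
theorem IrreducibleAperiodic.isCompact_tiltSet (hQ : Q.IrreducibleAperiodic) (o : S) :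
    IsCompact (Q.tiltSet o) := by
  obtain ⟨c₁, h₁⟩ := exists_tilt_bound (hQ.free_path (0, 0, o) (1, 0, o))
  obtain ⟨c₂, h₂⟩ := exists_tilt_bound (hQ.free_path (0, 0, o) (-1, 0, o))
  obtain ⟨c₃, h₃⟩ := exists_tilt_bound (hQ.free_path (0, 0, o) (0, 1, o))
  obtain ⟨c₄, h₄⟩ := exists_tilt_bound (hQ.free_path (0, 0, o) (0, -1, o))
  choose c₅ h₅ using fun j => exists_tilt_bound (hQ.free_path (0, 0, o) (0, 0, j))
  choose c₆ h₆ using fun j => exists_tilt_bound (hQ.free_path (0, 0, j) (0, 0, o))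
  refine (isCompact_Icc (a := ((-c₂, -c₄, fun j => -c₆ j) : ℝ × ℝ × (S → ℝ)))
    (b := (c₁, c₃, c₅))).of_isClosed_subset (Q.isClosed_tiltSet o) fun p ⟨hp0, hp⟩ => ?_
  refine ⟨⟨?_, ?_, fun j => ?_⟩, ?_, ?_, fun j => ?_⟩
  · have := h₂ p hp; simp at this; simpa using by linarith
  · have := h₄ p hp; simp at this; simpa using by linarith
  · have := h₆ j p hp; simp [hp0] at this; simpa using by linarith
  · have := h₁ p hp; simp at this; simpa using by linarith
  · have := h₃ p hp; simp at this; simpa using by linarith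
  · have := h₅ j p hp; simp [hp0] at this; simpa using by linarith

theorem fst_tiltSet_subset (o : S) :
    Prod.fst '' Q.tiltSet o ⊆ Prod.fst '' Q.GammaBar := by
  rintro _ ⟨p, ⟨-, hp⟩, rfl⟩
  refine ⟨(p.1, p.2.1), ?_, rfl⟩
  have : Nonempty S := ⟨o⟩
  rw [GammaBar, Set.mem_ofPred_eq, C_ofReal, ← ENNReal.ofReal_one]
  refine spr_le_of_superharmonic (M := Q.realC (Real.exp p.1) (Real.exp p.2.1))
    (fun j k => ?_) (v := fun j => Real.exp (p.2.2 j)) (fun j => Real.exp_pos _) fun j => ?_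
  · simp [abs_of_nonneg (Q.realC_nonneg (Real.exp_pos p.1) (Real.exp_pos p.2.1) j k)]
  · have := hp j
    rw [tiltedRowSum_eq, Real.exp_neg, inv_mul_le_iff₀ (Real.exp_pos _)] at this
    linarith

theorem IrreducibleAperiodic.fst_gammaBar_subset (hQ : Q.IrreducibleAperiodic) (o : S) :
    Prod.fst '' Q.GammaBar ⊆ Prod.fst '' Q.tiltSet o := by
  rintro _ ⟨s, hs, rfl⟩
  have : Nonempty S := ⟨o⟩
  rw [GammaBar, Set.mem_ofPred_eq, C_ofReal] at hs
  obtain ⟨v, hv, hle⟩ := (hQ.communicates_realC (Real.exp_pos s.1)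
    (Real.exp_pos s.2)).exists_superharmonic
    (Q.realC_nonneg (Real.exp_pos s.1) (Real.exp_pos s.2))
  refine ⟨(s.1, s.2, fun j => Real.log (v j / v o)), ⟨by simp [(hv o).ne'], fun j => ?_⟩, rfl⟩
  have hr : (spr ((Q.realC (Real.exp s.1) (Real.exp s.2)).map Complex.ofReal)).toReal ≤ 1 :=
    ENNReal.toReal_le_of_le_ofReal zero_le_one (by simpa using hs)
  have hvo := hv o
  have e : (fun j => Real.exp (Real.log (v j / v o))) = (v o)⁻¹ • v := by
    ext j
    rw [Real.exp_log (div_pos (hv j) hvo), Pi.smul_apply, smul_eq_mul, div_eq_inv_mul]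
  rw [tiltedRowSum_eq, Real.exp_neg, Real.exp_log (div_pos (hv j) hvo)]
  simp only [e, Matrix.mulVec_smul, Pi.smul_apply, smul_eq_mul]
  rw [inv_mul_le_iff₀ (div_pos (hv j) hvo), mul_one, div_eq_inv_mul]
  refine mul_le_mul_of_nonneg_left ((hle j).trans ?_) (inv_nonneg.2 hvo.le)
  exact mul_le_of_le_one_left (hv j).le hr

theorem zero_mem_tiltSet (o : S) : (0 : ℝ × ℝ × (S → ℝ)) ∈ Q.tiltSet o := by
  refine ⟨rfl, fun j => le_of_eq ?_⟩
  have := Q.A_stoch.2 j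
  simp only [Matrix.sum_apply] at this
  rw [← this, Finset.sum_comm]
  simp only [tiltedRowSum]
  simp [Finset.sum_comm (s := (Finset.univ : Finset S))]

/-- For `x` between the extreme values there are `y` and a positive vector that is superharmonic
for `C (x, y)`. -/
theorem IrreducibleAperiodic.exists_superharmonic_realC [Nonempty S]
    (hQ : Q.IrreducibleAperiodic) {x : ℝ} (hl : Q.zLower ≤ x) (hu : x ≤ Q.zUpper) :
    ∃ y : ℝ, 0 < y ∧ ∃ v : S → ℝ, (∀ j, 0 < v j) ∧ ∀ j, (Q.realC x y *ᵥ v) j ≤ v j := by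
  obtain ⟨o⟩ := ‹Nonempty S›
  have hx : 0 < x := (Real.exp_pos _).trans_le hl
  have himg : Prod.fst '' Q.GammaBar = Prod.fst '' Q.tiltSet o :=
    (hQ.fst_gammaBar_subset o).antisymm (fst_tiltSet_subset o)
  have hcomp : IsCompact (Prod.fst '' Q.tiltSet o) :=
    (hQ.isCompact_tiltSet o).image continuous_fst
  have hne : (Prod.fst '' Q.tiltSet o).Nonempty := ⟨_, 0, zero_mem_tiltSet o, rfl⟩
  have hconv : Convex ℝ (Prod.fst '' Q.tiltSet o) :=
    (Q.convex_tiltSet o).linear_image (LinearMap.fst ℝ ℝ (ℝ × (S → ℝ)))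
  -- The projection is compact and convex in $\mathbb R$, hence an interval containing its infimum
  -- and supremum.
  have hmem : Real.log x ∈ Prod.fst '' Q.tiltSet o := by
    refine hconv.ordConnected.out (hcomp.sInf_mem hne) (hcomp.sSup_mem hne) ⟨?_, ?_⟩
    · rw [← himg]; exact (Real.le_log_iff_exp_le hx).2 hl
    · rw [← himg]; exact (Real.log_le_iff_le_exp hx).2 hu
  obtain ⟨p, ⟨-, hp⟩, hpx⟩ := hmem
  refine ⟨Real.exp p.2.1, Real.exp_pos _, fun j => Real.exp (p.2.2 j), fun j => Real.exp_pos _,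
    fun j => ?_⟩
  have := hp j
  rw [tiltedRowSum_eq, Real.exp_neg, inv_mul_le_iff₀ (Real.exp_pos _), hpx, Real.exp_log hx] at this
  linarith

end Model

/-! ### Monomials in matrix products, and the real matrices that dominate at $|z|$. -/

theorem HasTerm.matrix_mul {S : Type*} [Fintype S] [DecidableEq S] {z : ℂ} (hz : z ≠ 0)
    {B B' : Matrix S S ℂ} {M M' : Matrix S S ℝ} {m m' : ℤ} {j k l : S}
    (h : HasTerm z (B j l) (M j l) m) (h' : HasTerm z (B' l k) (M' l k) m')
    (hB : Dominated B M) (hB' : Dominated B' M') :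
    HasTerm z ((B * B') j k) ((M * M') j k) (m + m') := by
  rw [Matrix.mul_apply, Matrix.mul_apply]
  refine HasTerm.sum (a := fun l => B j l * B' l k) (b := fun l => M j l * M' l k)
    (Finset.mem_univ l) (h.mul hz h') fun i _ => ?_
  rw [norm_mul]
  exact mul_le_mul (hB j i) (hB' i k) (norm_nonneg _) (hB.nonneg j i)

/-- A linear combination of nonnegative blocks with coefficients `z ^ i`. -/
theorem dominated_sum_zpow {S : Type*} [Fintype S] [DecidableEq S] (z : ℂ)
    {A : ℤ → Matrix S S ℝ} (hA : ∀ i ∈ H, ∀ a b, 0 ≤ A i a b) :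
    Dominated (∑ i ∈ H, z ^ i • (A i).map Complex.ofReal) (∑ i ∈ H, ‖z‖ ^ i • A i) := by
  intro a b
  simp only [Matrix.sum_apply]
  refine norm_sum_le_of_le _ fun i hi => ?_
  simp [abs_of_nonneg (hA i hi a b)]

theorem hasTerm_sum_zpow {S : Type*} [Fintype S] [DecidableEq S] (z : ℂ)
    {A : ℤ → Matrix S S ℝ} (hA : ∀ i ∈ H, ∀ a b, 0 ≤ A i a b) {i : ℤ} (hi : i ∈ H) {a b : S}
    (hpos : 0 < A i a b) :
    HasTerm z ((∑ i ∈ H, z ^ i • (A i).map Complex.ofReal) a b) ((∑ i ∈ H, ‖z‖ ^ i • A i) a b)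
      i := by
  simp only [Matrix.sum_apply]
  refine HasTerm.sum hi ⟨A i a b, hpos, ?_⟩ fun i hi => ?_
  · simp [mul_comm]
  · simp [abs_of_nonneg (hA i hi a b)]

namespace Model

variable {S : Type*} [Fintype S] [DecidableEq S] (Q : Model S)

/-- The matrix `A_{*,k}(x)` for real `x`. -/
noncomputable def realAStar (k : ℤ) (x : ℝ) : Matrix S S ℝ := ∑ i ∈ H, x ^ i • Q.A i k

/-- The matrix `A^{(1)}_{*,k}(x)` for real `x`. -/
noncomputable def realA1Star (k : ℤ) (x : ℝ) : Matrix S S ℝ := ∑ i ∈ H, x ^ i • Q.A1 i k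

/-- The matrix `G₁(x)` for real `x`. -/
noncomputable def realG1 (x : ℝ) : Matrix S S ℝ :=
  fun j k => ∑' n, descent (fun i => Q.realAStar i x) (n + 1) 1 j k

/-- The matrix `C₁(x, G₁(x))` for real `x`. -/
noncomputable def realC1 (x : ℝ) : Matrix S S ℝ := Q.realA1Star 0 x + Q.realA1Star 1 x * Q.realG1 x

variable {Q}

theorem sum_realAStar (x y : ℝ) : ∑ k ∈ H, y ^ k • Q.realAStar k x = Q.realC x y := by
  simp only [realAStar, realC, Finset.smul_sum, smul_smul]
  rw [Finset.sum_comm]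
  exact Finset.sum_congr rfl fun i _ => Finset.sum_congr rfl fun k _ => by rw [mul_comm]

theorem AStar_ofReal (k : ℤ) (x : ℝ) : Q.AStar k x = (Q.realAStar k x).map Complex.ofReal := by
  ext a b
  simp [AStar, realAStar, Matrix.sum_apply]

theorem A1Star_ofReal (k : ℤ) (x : ℝ) :
    Q.A1Star k x = (Q.realA1Star k x).map Complex.ofReal := by
  ext a b
  simp [A1Star, realA1Star, Matrix.sum_apply]

theorem dominated_AStar (z : ℂ) {k : ℤ} (hk : k ∈ H) :
    Dominated (Q.AStar k z) (Q.realAStar k ‖z‖) :=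
  dominated_sum_zpow z fun i hi => Q.A_nonneg i hi k hk

theorem dominated_A1Star (z : ℂ) {k : ℤ} (hk : k ∈ HPlus) :
    Dominated (Q.A1Star k z) (Q.realA1Star k ‖z‖) :=
  dominated_sum_zpow z fun i hi => Q.A1_nonneg i hi k hk

theorem dominated_D1 (z : ℂ) (n : ℕ) :
    Dominated (Q.D1 n z) (descent (fun i => Q.realAStar i ‖z‖) n 1) := by
  rw [D1_eq_descent]
  exact Dominated.descent (fun k hk => dominated_AStar z hk) n 1

/-! ### First passages with prescribed horizontal displacement. -/

section Excursion

variable {z : ℂ}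

/-- The first passage matrices from height `h` to height `0` in `n` steps have a term with
exponent `m` at the entry `(k, j)`. -/
def HasPassage (Q : Model S) (z : ℂ) (n h : ℕ) (k j : S) (m : ℤ) : Prop :=
  HasTerm z (descent (fun i => Q.AStar i z) n h k j)
    (descent (fun i => Q.realAStar i ‖z‖) n h k j) m

theorem hasPassage_zero (j : S) : Q.HasPassage z 0 0 j j 0 := ⟨1, one_pos, by simp [descent]⟩

theorem HasPassage.eq_of_height_zero (hz : z ≠ 0) {n : ℕ} {k j : S} {m : ℤ}
    (h : Q.HasPassage z n 0 k j m) : k = j := by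
  by_contra hkj
  have := HasTerm.pos hz h
  rcases n with _ | n <;> simp [descent, hkj] at this

/-- Prepending a step adds its horizontal increment to the exponent. One of the three summands in
`descent` carries the monomial; the other two are merely dominated. -/
theorem HasPassage.step (hz : z ≠ 0) {n h h' : ℕ} {k k' j : S} {i κ m : ℤ}
    (hp : Q.HasPassage z n h' k' j m) (h0 : h ≠ 0) (hi : i ∈ H) (hκ : κ ∈ H)
    (hh : (h' : ℤ) = h + κ) (hA : 0 < Q.A i κ k k') : Q.HasPassage z (n + 1) h k j (i + m) := by
  obtain ⟨h, rfl⟩ := Nat.exists_eq_succ_of_ne_zero h0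
  have hd : ∀ l, Dominated (descent (fun i => Q.AStar i z) n l)
      (descent (fun i => Q.realAStar i ‖z‖) n l) :=
    fun l => Dominated.descent (fun k hk => dominated_AStar z hk) n l
  have hdm : ∀ κ ∈ H, ∀ l, Dominated (Q.AStar κ z * descent (fun i => Q.AStar i z) n l)
      (Q.realAStar κ ‖z‖ * descent (fun i => Q.realAStar i ‖z‖) n l) :=
    fun κ hκ l => (dominated_AStar z hκ).mul (hd l)
  have hm := HasTerm.matrix_mul hz (hasTerm_sum_zpow z (fun i hi => Q.A_nonneg i hi κ hκ) hi hA)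
    hp (dominated_AStar z hκ) (hd h')
  rcases mem_H.1 hκ with rfl | rfl | rfl
  · obtain rfl : h' = h := by push_cast at hh; omega
    exact (hm.add_right (hdm 0 (by decide) _ _ _)).add_right (hdm 1 (by decide) _ _ _)
  · obtain rfl : h' = h + 1 := by push_cast at hh; omega
    exact (hm.add_left (hdm (-1) (by decide) _ _ _)).add_right (hdm 1 (by decide) _ _ _)
  · obtain rfl : h' = h + 2 := by push_cast at hh; omega
    exact hm.add_left ((hdm (-1) (by decide) _).add (hdm 0 (by decide) _) _ _)

theorem IrreducibleAperiodic.exists_hasPassage [Nonempty S] (hQ : Q.IrreducibleAperiodic)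
    (hz : z ≠ 0) (h : ℕ) (k : S) : ∃ n j m, Q.HasPassage z n h k j m := by
  obtain ⟨o⟩ := ‹Nonempty S›
  have hpath := hQ.one_path (0, h, k) (0, 0, o)
  suffices ∀ s : ℤ × ℕ × S, Relation.ReflTransGen (fun a b => 0 < Q.pOne a b) s (0, 0, o) →
      ∃ n j m, Q.HasPassage z n s.2.1 s.2.2 j m from this _ hpath
  intro s hs
  induction hs using Relation.ReflTransGen.head_induction_on with
  | refl => exact ⟨0, o, 0, hasPassage_zero o⟩
  | @head s s' hss _ ih =>
    obtain ⟨n, j, m, hp⟩ := ih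
    rcases Q.pOne_pos hss with ⟨h0, i, hi, κ, hκ, -, h2, hA⟩ | ⟨h0, -⟩
    · exact ⟨n + 1, j, i + m, hp.step hz h0 hi hκ h2 hA⟩
    -- At the boundary the rest of the path is discarded and the empty passage is used.
    · exact ⟨0, s.2.2, 0, by rw [h0]; exact hasPassage_zero _⟩

/-- A path of the free chain can be put in front of a first passage at all large heights. -/
theorem exists_hasPassage_of_free_path (hz : z ≠ 0) {x y : ℤ × ℤ × S}
    (hxy : Relation.ReflTransGen (fun a b => 0 < Q.pFree a b) x y) :
    ∃ L : ℕ, ∀ h h' : ℕ, L ≤ h → (h' : ℤ) = h + y.2.1 - x.2.1 → ∀ n j m,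
      Q.HasPassage z n h' y.2.2 j m → ∃ n', Q.HasPassage z n' h x.2.2 j (m + y.1 - x.1) := by
  induction hxy using Relation.ReflTransGen.head_induction_on with
  | refl =>
    refine ⟨0, fun h h' _ hh n j m hp => ⟨n, ?_⟩⟩
    obtain rfl : h' = h := by omega
    rwa [add_sub_cancel_right]
  | @head x w hxw _ ih =>
    obtain ⟨L, hL⟩ := ih
    obtain ⟨i, hi, κ, hκ, h1, h2, hA⟩ := Q.pFree_pos hxw
    -- A step lowers the height by at most one, so one extra unit per step keeps the path off the
    -- boundary.
    refine ⟨L + 1, fun h h' hLh hh n j m hp => ?_⟩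
    have hκ' := mem_H.1 hκ
    obtain ⟨h'', e⟩ : ∃ h'' : ℕ, (h'' : ℤ) = h + κ := ⟨(h + κ).toNat, by omega⟩
    obtain ⟨n', hn'⟩ := hL h'' h' (by omega) (by omega) n j m hp
    refine ⟨n' + 1, ?_⟩
    have := hn'.step hz (by omega) hi hκ e hA
    rwa [show i + (m + y.1 - w.1) = m + y.1 - x.1 by omega] at this

/-- First passages from height `h` and phase `k` with consecutive exponents. -/
def HasConsecutivePassages (Q : Model S) (z : ℂ) (h : ℕ) (k : S) : Prop :=
  ∃ j m n n', Q.HasPassage z n h k j m ∧ Q.HasPassage z n' h k j (m + 1)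

/-- High enough up, a free path returning to the same height and phase one unit to the right can
precede a given passage; this raises the exponent by one. -/
theorem IrreducibleAperiodic.exists_hasConsecutivePassages [Nonempty S]
    (hQ : Q.IrreducibleAperiodic) (hz : z ≠ 0) (k : S) :
    ∃ h : ℕ, h ≠ 0 ∧ Q.HasConsecutivePassages z h k := by
  obtain ⟨L, hL⟩ := exists_hasPassage_of_free_path hz (hQ.free_path (0, 0, k) (1, 0, k))
  obtain ⟨n, j, m, hp⟩ := hQ.exists_hasPassage hz (L + 1) k
  obtain ⟨n', hp'⟩ := hL (L + 1) (L + 1) (by omega) (by simp) n j m hp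
  exact ⟨L + 1, by omega, j, m, n, n', hp, by simpa using hp'⟩

/-- Follow a path from the boundary to the good state backwards. Consecutive passages persist while
the height is nonzero, down to the last departure from the boundary. -/
theorem IrreducibleAperiodic.exists_boundary_hasConsecutivePassages [Nonempty S]
    (hQ : Q.IrreducibleAperiodic) (hz : z ≠ 0) :
    ∃ i ∈ H, ∃ j l, 0 < Q.A1 i 1 j l ∧ Q.HasConsecutivePassages z 1 l := by
  obtain ⟨o⟩ := ‹Nonempty S›
  obtain ⟨h, h0, hc⟩ := hQ.exists_hasConsecutivePassages hz o
  suffices ∀ s : ℤ × ℕ × S, Relation.ReflTransGen (fun a b => 0 < Q.pOne a b) s (0, h, o) →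
      (s.2.1 ≠ 0 ∧ Q.HasConsecutivePassages z s.2.1 s.2.2) ∨
      ∃ i ∈ H, ∃ j l, 0 < Q.A1 i 1 j l ∧ Q.HasConsecutivePassages z 1 l by
    rcases this _ (hQ.one_path (0, 0, o) (0, h, o)) with h' | h'
    · exact absurd rfl h'.1
    · exact h'
  intro s hs
  induction hs using Relation.ReflTransGen.head_induction_on with
  | refl => exact .inl ⟨h0, hc⟩
  | @head s s' hss _ ih =>
    rcases ih with ⟨h0', j, m, n, n', hp, hp'⟩ | ih
    · rcases Q.pOne_pos hss with ⟨h0, i, hi, κ, hκ, -, h2, hA⟩ | ⟨h0, i, hi, κ, hκ, -, h2, hA⟩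
      · refine .inl ⟨h0, j, i + m, n + 1, n' + 1, hp.step hz h0 hi hκ h2 hA, ?_⟩
        rw [add_assoc]
        exact hp'.step hz h0 hi hκ h2 hA
      · have hκ' := mem_HPlus.1 hκ
        -- The height after the step is nonzero, so a step from the boundary must go up to height
        -- one.
        obtain rfl : κ = 1 := by omega
        have e : s'.2.1 = 1 := by omega
        rw [e] at hp hp'
        exact .inr ⟨i, hi, _, _, hA, j, m, n, n', hp, hp'⟩
    · exact .inr ih

end Excursion

/-! ### Assembly for $G_1$ and $C_1$. -/

section Main

variable {z : ℂ}

theorem dominated_realG1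
    (hs : ∀ j k, Summable fun n => descent (fun i => Q.realAStar i ‖z‖) n 1 j k) :
    Dominated (fun j k => ∑' n, descent (fun i => Q.AStar i z) (n + 1) 1 j k) (Q.realG1 ‖z‖) :=
  fun j k => tsum_of_norm_bounded
    ((summable_nat_add_iff (f := fun n => descent (fun i => Q.realAStar i ‖z‖) n 1 j k) 1).2
      (hs j k)).hasSum
    fun n => Dominated.descent (fun _ hk => dominated_AStar z hk) (n + 1) 1 j k

theorem summable_D1
    (hs : ∀ j k, Summable fun n => descent (fun i => Q.realAStar i ‖z‖) n 1 j k) :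
    Summable fun n => Q.D1 (n + 1) z := by
  refine Pi.summable.2 fun j => Pi.summable.2 fun k => ?_
  exact ((summable_nat_add_iff 1).2 (hs j k)).of_norm_bounded fun n => dominated_D1 z (n + 1) j k

theorem G1_eq (hs : ∀ j k, Summable fun n => descent (fun i => Q.realAStar i ‖z‖) n 1 j k) :
    Q.G1 z = fun j k => ∑' n, descent (fun i => Q.AStar i z) (n + 1) 1 j k := by
  have hsum := summable_D1 hs
  ext j k
  have h := (Pi.hasSum.1 (Pi.hasSum.1 hsum.hasSum j) k).tsum_eq
  simp only [D1_eq_descent] at h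
  simp only [G1, D1_eq_descent]
  exact h.symm

theorem HasPassage.hasTerm_G1 (hz : z ≠ 0)
    (hs : ∀ j k, Summable fun n => descent (fun i => Q.realAStar i ‖z‖) n 1 j k) {n : ℕ} {k j : S}
    {m : ℤ} (h : Q.HasPassage z n 1 k j m) : HasTerm z (Q.G1 z k j) (Q.realG1 ‖z‖ k j) m := by
  rcases n with _ | n
  · have := HasTerm.pos hz h
    simp [descent] at this
  · rw [G1_eq hs]
    exact HasTerm.tsum (a := fun n => descent (fun i => Q.AStar i z) (n + 1) 1 k j)
      (b := fun n => descent (fun i => Q.realAStar i ‖z‖) (n + 1) 1 k j) (i := n) h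
      (fun n => Dominated.descent (fun _ hk => dominated_AStar z hk) (n + 1) 1 k j)
      ((summable_nat_add_iff (f := fun n => descent (fun i => Q.realAStar i ‖z‖) n 1 k j) 1).2
        (hs k j))

theorem dominated_C1
    (hs : ∀ j k, Summable fun n => descent (fun i => Q.realAStar i ‖z‖) n 1 j k) :
    Dominated (Q.C1 z (Q.G1 z)) (Q.realC1 ‖z‖) := by
  rw [G1_eq hs]
  exact (dominated_A1Star z (by decide)).add
    ((dominated_A1Star z (by decide)).mul (dominated_realG1 hs))

theorem HasPassage.hasTerm_C1 (hz : z ≠ 0)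
    (hs : ∀ j k, Summable fun n => descent (fun i => Q.realAStar i ‖z‖) n 1 j k) {n : ℕ}
    {k l j : S} {m i : ℤ} (h : Q.HasPassage z n 1 l j m) (hi : i ∈ H) (hA : 0 < Q.A1 i 1 k l) :
    HasTerm z (Q.C1 z (Q.G1 z) k j) (Q.realC1 ‖z‖ k j) (i + m) := by
  have hG : Dominated (Q.G1 z) (Q.realG1 ‖z‖) := by rw [G1_eq hs]; exact dominated_realG1 hs
  refine HasTerm.add_left ?_ (dominated_A1Star z (by decide) k j)
  exact HasTerm.matrix_mul hz
    (hasTerm_sum_zpow z (fun i hi => Q.A1_nonneg i hi 1 (by decide)) hi hA) (h.hasTerm_G1 hz hs)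
    (dominated_A1Star z (by decide)) hG

theorem hasTerm_C1_of_boundary
    (hs : ∀ j k, Summable fun n => descent (fun i => Q.realAStar i ‖z‖) n 1 j k)
    {k j : S} {i : ℤ} (hi : i ∈ H) (hA : 0 < Q.A1 i 0 k j) :
    HasTerm z (Q.C1 z (Q.G1 z) k j) (Q.realC1 ‖z‖ k j) i := by
  have hG : Dominated (Q.G1 z) (Q.realG1 ‖z‖) := by rw [G1_eq hs]; exact dominated_realG1 hs
  exact HasTerm.add_right
    (hasTerm_sum_zpow z (fun i hi => Q.A1_nonneg i hi 0 (by decide)) hi hA)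
    ((dominated_A1Star z (by decide)).mul hG k j)

/-- Going backwards along a path, some first passage from the current state lands at a phase leading
to `b`. Steps off the boundary extend that passage; a boundary step followed by it gives a positive
entry of `realC1`. -/
theorem IrreducibleAperiodic.communicates_realC1 (hQ : Q.IrreducibleAperiodic) (hz : z ≠ 0)
    (hs : ∀ j k, Summable fun n => descent (fun i => Q.realAStar i ‖z‖) n 1 j k) :
    Communicates (Q.realC1 ‖z‖) := by
  intro a b
  suffices ∀ s : ℤ × ℕ × S, Relation.ReflTransGen (fun a b => 0 < Q.pOne a b) s (0, 0, b) →
      ∃ n j m, Q.HasPassage z n s.2.1 s.2.2 j m ∧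
        Relation.ReflTransGen (fun a b => 0 < Q.realC1 ‖z‖ a b) j b by
    obtain ⟨n, j, m, hp, hj⟩ := this _ (hQ.one_path (0, 0, a) (0, 0, b))
    obtain rfl : a = j := hp.eq_of_height_zero hz
    exact hj
  intro s hpath
  induction hpath using Relation.ReflTransGen.head_induction_on with
  | refl => exact ⟨0, b, 0, hasPassage_zero b, .refl⟩
  | @head s s' hss _ ih =>
    obtain ⟨n, j, m, hp, hj⟩ := ih
    rcases Q.pOne_pos hss with ⟨h0, i, hi, κ, hκ, -, h2, hA⟩ | ⟨h0, i, hi, κ, hκ, -, h2, hA⟩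
    · exact ⟨n + 1, j, i + m, hp.step hz h0 hi hκ h2 hA, hj⟩
    · refine ⟨0, s.2.2, 0, by rw [h0]; exact hasPassage_zero _, .head ?_ hj⟩
      rcases mem_HPlus.1 hκ with rfl | rfl
      · have e : s'.2.1 = 0 := by omega
        rw [e] at hp
        rw [← hp.eq_of_height_zero hz]
        exact (hasTerm_C1_of_boundary hs hi hA).pos hz
      · have e : s'.2.1 = 1 := by omega
        rw [e] at hp
        exact (hp.hasTerm_C1 hz hs hi hA).pos hz

theorem C1_ofReal {x : ℝ} (hx : 0 < x)
    (hs : ∀ j k, Summable fun n => descent (fun i => Q.realAStar i x) n 1 j k) :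
    Q.C1 x (Q.G1 x) = (Q.realC1 x).map Complex.ofReal := by
  have hn : ‖(x : ℂ)‖ = x := by simp [abs_of_pos hx]
  have hG : Q.G1 x = (Q.realG1 x).map Complex.ofReal := by
    rw [G1_eq (by rwa [hn])]
    ext j k
    rw [Matrix.map_apply, realG1, Complex.ofReal_tsum]
    refine tsum_congr fun n => ?_
    simp only [AStar_ofReal]
    have := map_descent (Complex.ofRealHom.mapMatrix (m := S)) (fun i => Q.realAStar i x) (n + 1) 1
    exact (congrFun (congrFun this j) k).symm
  rw [C1, hG, A1Star_ofReal, A1Star_ofReal, realC1]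
  exact ((congrArg (_ + ·) (map_mul (Complex.ofRealHom.mapMatrix (m := S)) _ _).symm).trans
    (map_add (Complex.ofRealHom.mapMatrix (m := S)) _ _).symm)

end Main

end Model

end TwoDQBD

theorem proposition5p2 {S : Type*} [Fintype S] [DecidableEq S] [Nonempty S]
    (Q : TwoDQBD.Model S) (hQ : Q.IrreducibleAperiodic)
    (z : ℂ) (hz_lower : Q.zLower < ‖z‖) (hz_upper : ‖z‖ ≤ Q.zUpper)
    (hz : z ≠ ((‖z‖ : ℝ) : ℂ)) :
    Summable (fun n : ℕ => Q.D1 (n + 1) z) ∧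
    Summable (fun n : ℕ => Q.D1 (n + 1) ((‖z‖ : ℝ) : ℂ)) ∧
    TwoDQBD.spr (Q.C1 z (Q.G1 z)) <
      TwoDQBD.spr (Q.C1 ((‖z‖ : ℝ) : ℂ) (Q.G1 ((‖z‖ : ℝ) : ℂ))) := by
  have hpos : 0 < ‖z‖ := (Real.exp_pos _).trans hz_lower
  have hz0 : z ≠ 0 := norm_pos_iff.1 hpos
  obtain ⟨y, hy, v, hv, hle⟩ := hQ.exists_superharmonic_realC hz_lower.le hz_upper
  have hs : ∀ j k, Summable fun n =>
      TwoDQBD.descent (fun i => Q.realAStar i ‖z‖) n 1 j k := by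
    refine TwoDQBD.summable_descent (fun k hk a b => ?_) hy hv ?_ 1
    · exact (TwoDQBD.Model.dominated_AStar z hk).nonneg a b
    · simpa only [TwoDQBD.Model.sum_realAStar] using hle
  refine ⟨TwoDQBD.Model.summable_D1 hs,
    TwoDQBD.Model.summable_D1 (by simpa using hs), ?_⟩
  rw [TwoDQBD.Model.C1_ofReal hpos hs]
  obtain ⟨i, hi, j, l, hA, j', m, n, n', hp, hp'⟩ :=
    hQ.exists_boundary_hasConsecutivePassages hz0
  refine (hQ.communicates_realC1 hz0 hs).spr_lt (TwoDQBD.Model.dominated_C1 hs)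
    (a := j) (b := j') ?_
  -- The common boundary step shifts both exponents by `i`, so the entry $(j,j')$ has terms
  -- $z^{i+m}$ and $z^{i+m+1}$.
  refine (hp.hasTerm_C1 hz0 hs hi hA).norm_lt hz0 hz ?_
  rw [add_assoc]
  exact hp'.hasTerm_C1 hz0 hs hi hA
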